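/- Let $G=(V,E)$ be a finite, simple, undirected, connected graph. The monophonic interval $I_m(u,v)$ of $u,v\in V$ is the set of vertices lying on some induced $(u,v)$-path of $G$. A set $S\subseteq V$ is m-convex if $I_m(u,v)\subseteq S$ for all $u,v\in S$, and an m-halfspace is an m-convex set $H\subseteq V$ whose complement $V\setminus H$ is m-convex. Let $\mathcal H_m(G)$ be the set of all m-halfspaces of $G$ and let $d$ be its VC-dimension, that is, the maximum size of a set $S\subseteq V$ such that $\{H\cap S: H\in\mathcal H_m(G)\}=2^S$. For $\mathcal C\subseteq 2^V$ and $C\in\mathcal C$, a teaching set for $C$ in $\mathcal C$ is a set $T\subseteq V\times\{-1,+1\}$ of labeled examples such that $C$ is the unique member of $\mathcal C$ consistent with $T$ (consistent means that, for every $(x,y)\in T$, $y=+1$ if $x\in C$ and $y=-1$ if $x\notin C$). Let $\mathrm{TS}(C,\mathcal C)$ be the minimum size of a teaching set for $C$ in $\mathcal C$. The teaching dimension of $\mathcal C$ is $\mathrm{TD}(\mathcal C)=\max_{C\in\mathcal C}\mathrm{TS}(C,\mathcal C)$ (and $0$ if $\mathcal C=\varnothing$). A teaching plan for $\mathcal C$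 is a sequence $P=((C_1,T_1),\dots,(C_N,T_N))$ in which $C_1,\dots,C_N$ enumerates $\mathcal C$ without repetition and each $T_i$ is a teaching set for $C_i$ in $\{C_i,\dots,C_N\}$; its order is $\max_i|T_i|$. The recursive teaching dimension $\mathrm{RTD}(\mathcal C)$ is the minimum order of a teaching plan for $\mathcal C$. Then $$\mathrm{TD}\bigl(\mathcal H_m(G)\setminus\{\varnothing,V\}\bigr)\le 2d+2\qquad\text{and}\qquad \mathrm{RTD}\bigl(\mathcal H_m(G)\bigr)\le 2d+2 .$$ -/

import Mathlib

namespace SimpleGraph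

variable {V : Type*}

/-- The monophonic interval `I_m(u, v)`: all vertices lying on some induced `(u, v)`-path. -/
def monophonicInterval (G : SimpleGraph V) (u v : V) : Set V :=
  {w | ∃ p : G.Walk u v, p.IsPath ∧ p.IsChordless ∧ w ∈ p.support}

/-- A set of vertices is m-convex if it contains the monophonic interval of any two of its
vertices. -/
def IsMConvex (G : SimpleGraph V) (S : Set V) : Prop :=
  ∀ u ∈ S, ∀ v ∈ S, G.monophonicInterval u v ⊆ S

/-- A monophonic halfspace is an m-convex set with m-convex complement. -/
def IsMHalfspace (G : SimpleGraph V) (H : Set V) : Prop :=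
  G.IsMConvex H ∧ G.IsMConvex Hᶜ

open Classical in
/-- The hypothesis space `H_m(G)` of all monophonic halfspaces of a finite graph `G`. -/
noncomputable def mHalfspaces [Fintype V] (G : SimpleGraph V) : Finset (Finset V) :=
  Finset.univ.filter fun H : Finset V => G.IsMHalfspace (H : Set V)

end SimpleGraph

namespace Teaching

variable {V : Type*}

/-- A hypothesis `C` is consistent with a set `T` of labeled examples `(x, y)` (the label `true`
stands for `+1` and `false` for `-1`) if `y = +1` when `x ∈ C` and `y = -1` when `x ∉ C`. -/
def Consistent (C : Finset V) (T : Finset (V × Bool)) : Prop :=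
  ∀ e ∈ T, (e.2 = true ↔ e.1 ∈ C)

/-- `T` is a teaching set for `C ∈ 𝒞`: the hypothesis `C` is the unique member of `𝒞` that is
consistent with `T`. -/
def IsTeachingSet (𝒞 : Finset (Finset V)) (C : Finset V) (T : Finset (V × Bool)) : Prop :=
  C ∈ 𝒞 ∧ Consistent C T ∧ ∀ C' ∈ 𝒞, Consistent C' T → C' = C

/-- `TS(C, 𝒞)`: the minimum size of a teaching set for `C` in `𝒞` (`⊤` if there is none). -/
noncomputable def minTeachingSize (𝒞 : Finset (Finset V)) (C : Finset V) : ℕ∞ :=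
  ⨅ (T : Finset (V × Bool)) (_ : IsTeachingSet 𝒞 C T), (T.card : ℕ∞)

/-- The teaching dimension `TD(𝒞)`: the maximum of `TS(C, 𝒞)` over `C ∈ 𝒞`. -/
noncomputable def teachingDim (𝒞 : Finset (Finset V)) : ℕ∞ :=
  ⨆ C ∈ 𝒞, minTeachingSize 𝒞 C

/-- A teaching plan for `𝒞`: an enumeration `C_1, …, C_N` of `𝒞` without repetition together with
sets `T(C_i)` of labeled examples such that `T(C_i)` is a teaching set for `C_i` in
`{C_i, …, C_N}`. -/
structure TeachingPlan [DecidableEq V] (𝒞 : Finset (Finset V)) where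
  N : ℕ
  concept : Fin N → Finset V
  examples : Fin N → Finset (V × Bool)
  concept_injective : Function.Injective concept
  image_concept : Finset.univ.image concept = 𝒞
  isTeachingSet : ∀ i, IsTeachingSet ((Finset.Ici i).image concept) (concept i) (examples i)

/-- `ord(P)`: the maximum size of the sets of examples used in the teaching plan `P`. -/
def TeachingPlan.ord [DecidableEq V] {𝒞 : Finset (Finset V)} (P : TeachingPlan 𝒞) : ℕ :=
  Finset.univ.sup fun i => (P.examples i).card

/-- The recursive teaching dimension `RTD(𝒞)`: the minimum of `ord(P)` over all teaching plans
`P` for `𝒞` (`⊤` if there is none). -/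
noncomputable def recursiveTeachingDim [DecidableEq V] (𝒞 : Finset (Finset V)) : ℕ∞ :=
  ⨅ P : TeachingPlan 𝒞, (P.ord : ℕ∞)

end Teaching

/-!
In a connected graph, a set `H` is a monophonic halfspace if and only if its inner boundary and its
outer boundary are cliques (`isMHalfspace_iff_hasCliqueBoundaries`).

Fix an edge `ab` and consider the halfspaces `H` with `a ∈ H` and `b ∉ H`. They are closed under
majority (`IsCliqueCut.majority`), so the differences `C ∆ D` between a fixed halfspace `C` and the
others are closed under intersection, and the minimal nonempty differences are pairwise disjoint.
A set that picks one vertex from each of them distinguishes `C` from every other halfspace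
cut by `ab`. Together with `a` and `b` themselves, which exclude the halfspaces not cut in this way,
it is a teaching set for `C` among all halfspaces.

It remains to see that there are at most `2d` minimal differences. If two disjoint differences
`M` and `N` both meet `C`, then `C ∆ (M ∪ N)` is again a halfspace (`IsCliqueCut.union`), and by
passing to complements the same holds if both meet the complement of `C`. Hence all unions of
minimal differences that meet `C` are differences, so representatives of these are
shattered and there are at most `d` of them; likewise for those that meet the complement of `C`
(`Finset.exists_card_le_two_mul_vcDim`).

For the recursive teaching dimension, the nontrivial halfspaces are taught first, by the same sets;
then only `∅` and `V` remain, which one example tells apart.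
-/

/-! ### Monophonic halfspaces and clique boundaries -/

namespace SimpleGraph

variable {V : Type*} {G : SimpleGraph V}

/-- A shortest walk inside the support of `p` is an induced path. -/
theorem Walk.exists_isPath_isChordless {u v : V} (p : G.Walk u v) :
    ∃ q : G.Walk u v, q.IsPath ∧ q.IsChordless ∧ q.support ⊆ p.support := by
  classical
  have hex : ∃ n, ∃ q : G.Walk u v, q.length = n ∧ q.support ⊆ p.support :=
    ⟨_, p, rfl, List.Subset.refl _⟩
  obtain ⟨q, hq, hqs⟩ := Nat.find_spec hex
  have hmin : ∀ r : G.Walk u v, r.support ⊆ p.support → q.length ≤ r.length := fun r hr =>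
    hq ▸ Nat.find_min' hex ⟨r, rfl, hr⟩
  -- A chord from `c` to a later vertex `d` would give a shortcut.
  have key : ∀ c d (hc : c ∈ q.support), d ∈ (q.dropUntil c hc).support → G.Adj c d →
      s(c, d) ∈ q.edges := by
    intro c d hc hd hcd
    have h1 := hmin ((q.takeUntil c hc).append (Walk.cons hcd ((q.dropUntil c hc).dropUntil d hd)))
      (by
        intro z hz
        rw [Walk.mem_support_append_iff, Walk.support_cons, List.mem_cons] at hz
        rcases hz with hz | rfl | hz
        · exact hqs (q.support_takeUntil_subset_support hc hz)
        · exact hqs hc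
        · exact hqs (q.support_dropUntil_subset_support hc
            (Walk.support_dropUntil_subset_support _ hd hz)))
    have h2 := congrArg Walk.length (q.take_spec hc)
    have h3 := congrArg Walk.length ((q.dropUntil c hc).take_spec hd)
    simp only [Walk.length_append, Walk.length_cons] at h1 h2 h3
    have hsub := (q.dropUntil c hc).edges_takeUntil_subset_edges hd
    generalize (q.dropUntil c hc).takeUntil d hd = r at h3 hsub
    refine q.edges_dropUntil_subset_edges hc (hsub ?_)
    match r, h3 with
    | .nil, _ => exact (G.irrefl hcd).elim
    | .cons h .nil, _ => simp
    | .cons h (.cons h' r), h3 => simp only [Walk.length_cons] at h3; omega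
  refine ⟨q, ?_, ?_, hqs⟩
  · have h1 := hmin q.bypass fun z hz => hqs (q.support_bypass_subset_support hz)
    exact q.bypass_eq_self_of_length_le_length_bypass h1 ▸ q.bypass_isPath
  · rw [Walk.isChordless_iff_forall_mem_edges]
    intro c d hc hd hcd
    have hd' := hd
    rw [← q.take_spec hc, Walk.mem_support_append_iff] at hd'
    rcases hd' with hd' | hd'
    · have hc' : c ∈ (q.dropUntil d hd).support := by
        have hc1 := hc
        rw [← q.take_spec hd, Walk.mem_support_append_iff] at hc1
        exact hc1.resolve_left
          (Walk.notMem_support_takeUntil_support_takeUntil_subset hcd.ne' hc hd')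
      exact Sym2.eq_swap ▸ key d c hd hc' hcd.symm
    · exact key c d hc hd' hcd

/-- The two conditions say that the vertices of `H` with a neighbour outside `H` form a clique, and
so do the vertices outside `H` with a neighbour in `H`. -/
structure HasCliqueBoundaries (G : SimpleGraph V) (H : Set V) : Prop where
  inner : ∀ ⦃x y x' y'⦄, x ∈ H → y ∈ H → x' ∉ H → y' ∉ H → G.Adj x x' → G.Adj y y' → x ≠ y →
    G.Adj x y
  outer : ∀ ⦃x y x' y'⦄, x ∈ H → y ∈ H → x' ∉ H → y' ∉ H → G.Adj x x' → G.Adj y y' → x' ≠ y' →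
    G.Adj x' y'

theorem HasCliqueBoundaries.compl {H : Set V} (h : G.HasCliqueBoundaries H) :
    G.HasCliqueBoundaries Hᶜ where
  inner x y x' y' hx hy hx' hy' ex ey hne := by
    simp only [Set.mem_compl_iff, not_not] at hx hy hx' hy'
    exact h.outer hx' hy' hx hy ex.symm ey.symm hne
  outer x y x' y' hx hy hx' hy' ex ey hne := by
    simp only [Set.mem_compl_iff, not_not] at hx hy hx' hy'
    exact h.inner hx' hy' hx hy ex.symm ey.symm hne

theorem IsMHalfspace.compl {H : Set V} (h : G.IsMHalfspace H) : G.IsMHalfspace Hᶜ :=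
  ⟨h.2, by rw [compl_compl]; exact h.1⟩

/-- An induced path that leaves and re-enters `H` crosses the inner boundary at two distinct vertices
that are not consecutive on the path, so these cannot be adjacent. -/
theorem isMConvex_of_innerBoundary {H : Set V}
    (h : ∀ ⦃x y x' y'⦄, x ∈ H → y ∈ H → x' ∉ H → y' ∉ H → G.Adj x x' → G.Adj y y' → x ≠ y →
      G.Adj x y) : G.IsMConvex H := by
  classical
  rintro u hu v hv w ⟨p, hp, hpc, hw⟩
  by_contra hwH
  obtain ⟨d, hd, hd1, hd2⟩ := (p.takeUntil w hw).exists_boundary_dart H hu hwH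
  obtain ⟨e, he, he1, he2⟩ := (p.dropUntil w hw).exists_boundary_dart Hᶜ hwH (by simpa using hv)
  have he2 : e.snd ∈ H := by simpa using he2
  have hx := (p.takeUntil w hw).dart_fst_mem_support_of_mem_darts hd
  have hy := (p.dropUntil w hw).dart_snd_mem_support_of_mem_darts he
  -- The two halves of the path only meet in `w`.
  have hmeet : ∀ z ∈ H, z ∈ (p.takeUntil w hw).support → z ∉ (p.dropUntil w hw).support := by
    intro z hz h1 h2
    exact Walk.IsPath.ne_of_mem_support_of_append (by rwa [p.take_spec hw])
      (fun hzw : z = w => hwH (hzw ▸ hz)) h1 h2 rfl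
  have hne : d.fst ≠ e.snd := fun heq => hmeet _ hd1 hx (heq ▸ hy)
  have hadj := h hd1 he2 hd2 he1 d.adj e.adj.symm hne
  have hedge := hpc.mem_edges (p.support_takeUntil_subset_support hw hx)
    (p.support_dropUntil_subset_support hw hy) hadj
  rw [← p.take_spec hw, Walk.edges_append, List.mem_append] at hedge
  rcases hedge with hedge | hedge
  · exact hmeet _ he2 (Walk.snd_mem_support_of_mem_edges _ hedge) hy
  · exact hmeet _ hd1 hx (Walk.fst_mem_support_of_mem_edges _ hedge)

theorem IsMConvex.exists_walk {S : Set V} (h : G.IsMConvex S) (hG : G.Connected) {u v : V}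
    (hu : u ∈ S) (hv : v ∈ S) : ∃ p : G.Walk u v, ∀ z ∈ p.support, z ∈ S := by
  obtain ⟨p⟩ := hG.preconnected u v
  obtain ⟨q, hq, hqc, -⟩ := p.exists_isPath_isChordless
  exact ⟨q, fun z hz => h u hu v hv ⟨q, hq, hqc, hz⟩⟩

theorem IsMHalfspace.innerBoundary (hG : G.Connected) {H : Set V} (h : G.IsMHalfspace H)
    {x y x' y' : V} (hx : x ∈ H) (hy : y ∈ H) (hx' : x' ∉ H) (hy' : y' ∉ H)
    (ex : G.Adj x x') (ey : G.Adj y y') (hne : x ≠ y) : G.Adj x y := by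
  by_contra hxy
  obtain ⟨p, hp⟩ := h.2.exists_walk hG hx' hy'
  -- A shortest path from `x` to `y` through the complement of `H` leaves `H`.
  obtain ⟨q, hq, hqc, hqs⟩ :=
    (Walk.cons ex (p.append (Walk.cons ey.symm Walk.nil))).exists_isPath_isChordless
  have hqH : ∀ z ∈ q.support, z ∈ H := fun z hz => h.1 x hx y hy ⟨q, hq, hqc, hz⟩
  have hqxy : ∀ z ∈ q.support, z = x ∨ z = y := by
    intro z hz
    have h1 := hqs hz
    simp only [Walk.support_cons, Walk.mem_support_append_iff, List.mem_cons, Walk.support_nil,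
      List.not_mem_nil, or_false] at h1
    rcases h1 with h1 | h1 | h1 | h1
    · exact .inl h1
    · exact absurd (hqH z hz) (hp z h1)
    · exact absurd (hqH z hz) (h1 ▸ hy')
    · exact .inr h1
  cases q with
  | nil => exact hne rfl
  | @cons _ z _ hadj r =>
    rcases hqxy z (by simp) with h1 | h1
    · exact G.irrefl (h1 ▸ hadj)
    · exact hxy (h1 ▸ hadj)

theorem isMHalfspace_iff_hasCliqueBoundaries (hG : G.Connected) {H : Set V} :
    G.IsMHalfspace H ↔ G.HasCliqueBoundaries H := by
  refine ⟨fun h => ⟨fun x y x' y' => h.innerBoundary hG, fun x y x' y' hx hy hx' hy' ex ey hne => ?_⟩,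
    fun h => ⟨isMConvex_of_innerBoundary h.inner, isMConvex_of_innerBoundary h.compl.inner⟩⟩
  exact h.compl.innerBoundary hG hx' hy' (not_not.2 hx) (not_not.2 hy) ex.symm ey.symm hne

end SimpleGraph

/-! ### Clique cuts along a fixed edge -/

namespace SimpleGraph

variable {V : Type*} {G : SimpleGraph V}

/-- `H` has clique boundaries and is cut by the edge `ab`, with `a` inside and `b` outside. For
connected `G` these are the monophonic halfspaces separating `a` from `b`. -/
structure IsCliqueCut (G : SimpleGraph V) (a b : V) (H : Set V) : Prop
    extends G.HasCliqueBoundaries H where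
  adj : G.Adj a b
  left_mem : a ∈ H
  right_notMem : b ∉ H

namespace IsCliqueCut

variable {a b : V} {H H₁ H₂ H₃ : Set V}

theorem compl (h : G.IsCliqueCut a b H) : G.IsCliqueCut b a Hᶜ where
  toHasCliqueBoundaries := h.toHasCliqueBoundaries.compl
  adj := h.adj.symm
  left_mem := h.right_notMem
  right_notMem := not_not.2 h.left_mem

theorem adj_left (h : G.IsCliqueCut a b H) {x x' : V} (hx : x ∈ H) (hx' : x' ∉ H)
    (e : G.Adj x x') (hne : x ≠ a) : G.Adj x a :=
  h.inner hx h.left_mem hx' h.right_notMem e h.adj hne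

theorem adj_right (h : G.IsCliqueCut a b H) {x x' : V} (hx : x ∈ H) (hx' : x' ∉ H)
    (e : G.Adj x x') (hne : x' ≠ b) : G.Adj x' b :=
  h.outer hx h.left_mem hx' h.right_notMem e h.adj hne

theorem mem_of_adj_left (h : G.IsCliqueCut a b H) {x : V} (e : G.Adj x a) (hb : ¬ G.Adj x b)
    (hne : x ≠ b) : x ∈ H := by
  by_contra hx
  exact hb (h.adj_right h.left_mem hx e.symm hne)

/-- A vertex in the inner boundary of one cut that is not adjacent to `b` lies on the side of `a` in
every cut. -/
theorem adj_or_mem (h : G.IsCliqueCut a b H) (h₁ : G.IsCliqueCut a b H₁) {x x' : V} (hx : x ∈ H)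
    (hx' : x' ∉ H) (e : G.Adj x x') : G.Adj x b ∨ x ∈ H₁ := by
  by_cases hxa : x = a
  · exact .inl (hxa ▸ h.adj)
  · by_cases hb : G.Adj x b
    · exact .inl hb
    · exact .inr (h₁.mem_of_adj_left (h.adj_left hx hx' e hxa) hb fun hxb => h.right_notMem (hxb ▸ hx))

theorem majority_inner (h₁ : G.IsCliqueCut a b H₁) (h₂ : G.IsCliqueCut a b H₂)
    (h₃ : G.IsCliqueCut a b H₃) {M : Set V}
    (hM : ∀ v, v ∈ M ↔ v ∈ H₁ ∧ v ∈ H₂ ∨ v ∈ H₁ ∧ v ∈ H₃ ∨ v ∈ H₂ ∧ v ∈ H₃)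
    ⦃x y x' y' : V⦄ (hx : x ∈ M) (hy : y ∈ M) (hx' : x' ∉ M) (hy' : y' ∉ M) (ex : G.Adj x x')
    (ey : G.Adj y y') (hne : x ≠ y) : G.Adj x y := by
  -- A vertex in the inner boundary of `M` is adjacent to `b` or contained in all three cuts.
  have key : ∀ z z', z ∈ M → z' ∉ M → G.Adj z z' → G.Adj z b ∨ z ∈ H₁ ∧ z ∈ H₂ ∧ z ∈ H₃ := by
    intro z z' hz hz' e
    rw [hM] at hz hz'
    clear hM
    obtain ⟨hz₁, hz₁'⟩ | ⟨hz₂, hz₂'⟩ | ⟨hz₃, hz₃'⟩ :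
        z ∈ H₁ ∧ z' ∉ H₁ ∨ z ∈ H₂ ∧ z' ∉ H₂ ∨ z ∈ H₃ ∧ z' ∉ H₃ := by grind
    · have := h₁.adj_or_mem h₂ hz₁ hz₁' e
      have := h₁.adj_or_mem h₃ hz₁ hz₁' e
      tauto
    · have := h₂.adj_or_mem h₁ hz₂ hz₂' e
      have := h₂.adj_or_mem h₃ hz₂ hz₂' e
      tauto
    · have := h₃.adj_or_mem h₁ hz₃ hz₃' e
      have := h₃.adj_or_mem h₂ hz₃ hz₃' e
      tauto
  have h1 := key x x' hx hx' ex
  have h2 := key y y' hy hy' ey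
  rw [hM] at hx hy hx' hy'
  have i₁ := @h₁.inner x y
  have i₂ := @h₂.inner x y
  have i₃ := @h₃.inner x y
  have := h₁.right_notMem
  have := h₂.right_notMem
  have := h₃.right_notMem
  by_cases hxb : G.Adj x b <;> by_cases hyb : G.Adj y b <;> grind

/-- The cuts along `ab` are closed under taking majorities: they form a median set. -/
theorem majority (h₁ : G.IsCliqueCut a b H₁) (h₂ : G.IsCliqueCut a b H₂)
    (h₃ : G.IsCliqueCut a b H₃) {M : Set V}
    (hM : ∀ v, v ∈ M ↔ v ∈ H₁ ∧ v ∈ H₂ ∨ v ∈ H₁ ∧ v ∈ H₃ ∨ v ∈ H₂ ∧ v ∈ H₃) :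
    G.IsCliqueCut a b M where
  inner := h₁.majority_inner h₂ h₃ hM
  outer x y x' y' hx hy hx' hy' ex ey hne := by
    refine h₁.compl.majority_inner h₂.compl h₃.compl (M := Mᶜ) (fun v => ?_) hx' hy' (not_not.2 hx)
      (not_not.2 hy) ex.symm ey.symm hne
    simp only [Set.mem_compl_iff, hM]
    tauto
  adj := h₁.adj
  left_mem := (hM a).2 (.inl ⟨h₁.left_mem, h₂.left_mem⟩)
  right_notMem := by
    have := h₁.right_notMem
    have := h₂.right_notMem
    rw [hM]
    tauto

/-- If `H₁` drops a vertex of `H`, then it drops a common neighbour of `a` and `b`: by connectivity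
some edge leaves `H \ H₁`, and its end in `H \ H₁` is a boundary vertex of `H` or of `H₁`. -/
theorem exists_mem_adj_both (hG : G.Connected) (h : G.IsCliqueCut a b H)
    (h₁ : G.IsCliqueCut a b H₁) {v : V} (hv : v ∈ H) (hv₁ : v ∉ H₁) :
    ∃ p ∈ H, p ∉ H₁ ∧ G.Adj p a ∧ G.Adj p b := by
  obtain ⟨w⟩ := hG.preconnected v b
  obtain ⟨d, -, hd, hd'⟩ := w.exists_boundary_dart (H \ H₁) ⟨hv, hv₁⟩
    (fun hb => h.right_notMem hb.1)
  have e := d.adj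
  generalize d.fst = p at *
  generalize d.snd = q at *
  refine ⟨p, hd.1, hd.2, ?_⟩
  have hpa : p ≠ a := fun hpa => hd.2 (hpa ▸ h₁.left_mem)
  have hpb : p ≠ b := fun hpb => h.right_notMem (hpb ▸ hd.1)
  by_cases hq : q ∈ H
  · have hq₁ : q ∈ H₁ := by
      by_contra hq₁
      exact hd' ⟨hq, hq₁⟩
    have hb := h₁.adj_right hq₁ hd.2 e.symm hpb
    exact ⟨h.adj_left hd.1 h.right_notMem hb hpa, hb⟩
  · have ha := h.adj_left hd.1 hq e hpa
    exact ⟨ha, h₁.adj_right h₁.left_mem hd.2 ha.symm hpb⟩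

/-- The vertex `p` links the two cuts: being in the inner boundary of `H₁`, it is adjacent to `x`, and
being outside `H₂`, it puts `x` into the inner boundary of `H₂`. -/
theorem adj_of_mem_of_notMem (h₁ : G.IsCliqueCut a b H₁) (h₂ : G.IsCliqueCut a b H₂)
    {x y x' y' p : V} (hx₁ : x ∈ H₁) (hx₂ : x ∈ H₂) (hx' : x' ∉ H₁) (ex : G.Adj x x')
    (hp₁ : p ∈ H₁) (hp₂ : p ∉ H₂) (hpb : G.Adj p b) (hy : y ∈ H₂) (hy' : y' ∉ H₂)
    (ey : G.Adj y y') (hne : x ≠ y) : G.Adj x y := by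
  have hxp : G.Adj x p :=
    h₁.inner hx₁ hp₁ hx' h₁.right_notMem ex hpb fun hxp => hp₂ (hxp ▸ hx₂)
  exact h₂.inner hx₂ hy hp₂ hy' hxp ey hne

/-- The hypothesis `hH₃` says that `H₁` and `H₂` differ from `H` in disjoint sets and that `H₃`
differs from `H` in the union of these. The only configurations not settled inside `H`, `H₁` or `H₂`
alone have a boundary vertex `x` not adjacent to `b`, and one of `p`, `q` or a neighbour outside `H₃`
then serves in `adj_of_mem_of_notMem`. -/
theorem union_inner (h : G.IsCliqueCut a b H) (h₁ : G.IsCliqueCut a b H₁)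
    (h₂ : G.IsCliqueCut a b H₂)
    (hH₃ : ∀ v, (v ∈ H₁ ↔ v ∈ H) ∧ (v ∈ H₃ ↔ v ∈ H₂) ∨ (v ∈ H₂ ↔ v ∈ H) ∧ (v ∈ H₃ ↔ v ∈ H₁))
    {p q : V} (hp₁ : p ∈ H₁) (hp₂ : p ∉ H₂) (hpb : G.Adj p b) (hq₂ : q ∈ H₂) (hq₁ : q ∉ H₁)
    (hqb : G.Adj q b) ⦃x y x' y' : V⦄ (hx : x ∈ H₃) (hy : y ∈ H₃) (hx' : x' ∉ H₃) (hy' : y' ∉ H₃)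
    (ex : G.Adj x x') (ey : G.Adj y y') (hne : x ≠ y) : G.Adj x y := by
  have bH := h.right_notMem
  have b₁ := h₁.right_notMem
  have b₂ := h₂.right_notMem
  -- A vertex in the inner boundary of `H₃` is adjacent to `b` or contained in all three cuts.
  have key : ∀ z z', z ∈ H₃ → z' ∉ H₃ → G.Adj z z' →
      G.Adj z b ∨ z ∈ H ∧ z ∈ H₁ ∧ z ∈ H₂ := by
    intro z z' hz hz' e
    obtain ⟨hz₁, hz₁'⟩ | ⟨hz₂, hz₂'⟩ | ⟨hz₀, hz₀', hzb⟩ :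
        z ∈ H₁ ∧ z' ∉ H₁ ∨ z ∈ H₂ ∧ z' ∉ H₂ ∨ z ∉ H ∧ z' ∈ H ∧ z ≠ b := by grind
    · have := h₁.adj_or_mem h hz₁ hz₁' e
      have := h₁.adj_or_mem h₂ hz₁ hz₁' e
      tauto
    · have := h₂.adj_or_mem h hz₂ hz₂' e
      have := h₂.adj_or_mem h₁ hz₂ hz₂' e
      tauto
    · exact .inl (h.adj_right hz₀' hz₀ e.symm hzb)
  have mixed : ∀ x y x', x ∈ H₁ → x ∈ H₂ → y ∈ H₃ → x' ∉ H₃ → G.Adj x x' → G.Adj y b → x ≠ y →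
      G.Adj x y := by
    intro x y x' hx₁ hx₂ hy hx' ex hyb hne
    obtain ⟨hy₁, hx₁'⟩ | ⟨hy₂, hx₂'⟩ | ⟨hy₂, hx₁'⟩ | ⟨hy₁, hx₂'⟩ :
        y ∈ H₁ ∧ x' ∉ H₁ ∨ y ∈ H₂ ∧ x' ∉ H₂ ∨ y ∈ H₂ ∧ x' ∉ H₁ ∨ y ∈ H₁ ∧ x' ∉ H₂ := by grind
    · exact h₁.inner hx₁ hy₁ hx₁' b₁ ex hyb hne
    · exact h₂.inner hx₂ hy₂ hx₂' b₂ ex hyb hne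
    · exact h₁.adj_of_mem_of_notMem h₂ hx₁ hx₂ hx₁' ex hp₁ hp₂ hpb hy₂ b₂ hyb hne
    · exact h₂.adj_of_mem_of_notMem h₁ hx₂ hx₁ hx₂' ex hq₂ hq₁ hqb hy₁ b₁ hyb hne
  rcases key x x' hx hx' ex with hxb | ⟨hxH, hx₁, hx₂⟩ <;>
    rcases key y y' hy hy' ey with hyb | ⟨hyH, hy₁, hy₂⟩
  · obtain ⟨hx₁, hy₁⟩ | ⟨hx₂, hy₂⟩ | ⟨hxH, hyH, hxU, hyU⟩ :
        x ∈ H₁ ∧ y ∈ H₁ ∨ x ∈ H₂ ∧ y ∈ H₂ ∨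
          x ∉ H ∧ y ∉ H ∧ (x ∈ H₁ ∨ x ∈ H₂) ∧ (y ∈ H₁ ∨ y ∈ H₂) := by grind
    · exact h₁.inner hx₁ hy₁ b₁ b₁ hxb hyb hne
    · exact h₂.inner hx₂ hy₂ b₂ b₂ hxb hyb hne
    · -- Both vertices are common neighbours of `a` and `b` outside `H`.
      have key' : ∀ z, z ∉ H → (z ∈ H₁ ∨ z ∈ H₂) → G.Adj z b → G.Adj z a := by
        intro z hz hzU hzb
        have hza : z ≠ a := fun hza => hz (hza ▸ h.left_mem)
        exact hzU.elim (fun hz₁ => h₁.adj_left hz₁ b₁ hzb hza)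
          (fun hz₂ => h₂.adj_left hz₂ b₂ hzb hza)
      exact h.outer h.left_mem h.left_mem hxH hyH (key' x hxH hxU hxb).symm
        (key' y hyH hyU hyb).symm hne
  · exact (mixed y x y' hy₁ hy₂ hx hy' ey hxb hne.symm).symm
  · exact mixed x y x' hx₁ hx₂ hy hx' ex hyb hne
  · obtain ⟨hx₁', hy₁'⟩ | ⟨hx₂', hy₂'⟩ | ⟨hx₁', hy₁', hy₂'⟩ | ⟨hx₂', hy₂', hy₁'⟩ :
        x' ∉ H₁ ∧ y' ∉ H₁ ∨ x' ∉ H₂ ∧ y' ∉ H₂ ∨ x' ∉ H₁ ∧ y' ∈ H₁ ∧ y' ∉ H₂ ∨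
          x' ∉ H₂ ∧ y' ∈ H₂ ∧ y' ∉ H₁ := by grind
    · exact h₁.inner hx₁ hy₁ hx₁' hy₁' ex ey hne
    · exact h₂.inner hx₂ hy₂ hx₂' hy₂' ex ey hne
    · exact h₁.adj_of_mem_of_notMem h₂ hx₁ hx₂ hx₁' ex hy₁' hy₂'
        (h₂.adj_right hy₂ hy₂' ey fun hb => b₁ (hb ▸ hy₁')) hy₂ hy₂' ey hne
    · exact h₂.adj_of_mem_of_notMem h₁ hx₂ hx₁ hx₂' ex hy₂' hy₁'
        (h₁.adj_right hy₁ hy₁' ey fun hb => b₂ (hb ▸ hy₂')) hy₁ hy₁' ey hne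

/-- Two disjoint modifications of a cut `H` can be carried out together, provided that each of them
moves some vertex of `H` out of `H`. -/
theorem union (hG : G.Connected) (h : G.IsCliqueCut a b H) (h₁ : G.IsCliqueCut a b H₁)
    (h₂ : G.IsCliqueCut a b H₂)
    (hH₃ : ∀ v, (v ∈ H₁ ↔ v ∈ H) ∧ (v ∈ H₃ ↔ v ∈ H₂) ∨ (v ∈ H₂ ↔ v ∈ H) ∧ (v ∈ H₃ ↔ v ∈ H₁))
    {v₁ v₂ : V} (hv₁ : v₁ ∈ H) (hv₁' : v₁ ∉ H₁) (hv₂ : v₂ ∈ H) (hv₂' : v₂ ∉ H₂) :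
    G.IsCliqueCut a b H₃ := by
  obtain ⟨q, hq, hq₁, hqa, hqb⟩ := h.exists_mem_adj_both hG h₁ hv₁ hv₁'
  obtain ⟨p, hp, hp₂, hpa, hpb⟩ := h.exists_mem_adj_both hG h₂ hv₂ hv₂'
  have hp₁ : p ∈ H₁ := by have := hH₃ p; tauto
  have hq₂ : q ∈ H₂ := by have := hH₃ q; tauto
  refine ⟨⟨h.union_inner h₁ h₂ hH₃ hp₁ hp₂ hpb hq₂ hq₁ hqb,
    fun x y x' y' hx hy hx' hy' ex ey hne => ?_⟩, h.adj, ?_, ?_⟩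
  · refine h.compl.union_inner h₁.compl h₂.compl (H₃ := H₃ᶜ) (fun v => ?_) hq₁ (not_not.2 hq₂) hqa
      hp₂ (not_not.2 hp₁) hpa hx' hy' (not_not.2 hx) (not_not.2 hy) ex.symm ey.symm hne
    simpa only [Set.mem_compl_iff, not_iff_not] using hH₃ v
  · have := hH₃ a
    have := h₁.left_mem
    have := h₂.left_mem
    tauto
  · have := hH₃ b
    have := h₁.right_notMem
    have := h₂.right_notMem
    tauto

end IsCliqueCut
end SimpleGraph

/-! ### Free differences and the VC-dimension -/

namespace Finset

open scoped symmDiff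

variable {V : Type*} [DecidableEq V]

/-- A family that contains all modifications of `C` on unions of members of a disjoint family `𝓙`
shatters a system of representatives of `𝓙`. -/
theorem card_le_vcDim_of_symmDiff_sup_mem {𝒜 : Finset (Finset V)} {C : Finset V}
    {𝓙 : Finset (Finset V)} (hdisj : ∀ M ∈ 𝓙, ∀ N ∈ 𝓙, M ≠ N → Disjoint M N)
    (hne : ∀ M ∈ 𝓙, M.Nonempty) (h𝒜 : ∀ J ⊆ 𝓙, C ∆ J.sup id ∈ 𝒜) : 𝓙.card ≤ 𝒜.vcDim := by
  rcases 𝓙.eq_empty_or_nonempty with rfl | ⟨M₀, hM₀⟩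
  · simp
  have : Nonempty V := (hne M₀ hM₀).to_type
  choose! r hr using hne
  have hinj : Set.InjOn r 𝓙 := by
    intro M hM N hN hMN
    by_contra h
    exact Finset.disjoint_left.1 (hdisj M hM N hN h) (hr M hM) (hMN ▸ hr N hN)
  rw [← card_image_of_injOn hinj]
  refine Shatters.card_le_vcDim fun t ht => ?_
  refine ⟨_, h𝒜 (𝓙.filter fun M => r M ∈ t ∆ C) (filter_subset _ _), ?_⟩
  have key : ∀ M ∈ 𝓙, (r M ∈ (𝓙.filter fun M => r M ∈ t ∆ C).sup id ↔ r M ∈ t ∆ C) := by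
    intro M hM
    simp only [mem_sup, mem_filter, id]
    refine ⟨fun ⟨N, ⟨hN, hNt⟩, hMN⟩ => ?_, fun h => ⟨M, ⟨hM, h⟩, hr M hM⟩⟩
    have hNM : N = M := by
      by_contra h
      exact Finset.disjoint_left.1 (hdisj N hN M hM h) hMN (hr M hM)
    exact hNM ▸ hNt
  ext v
  rw [mem_inter, mem_image]
  constructor
  · rintro ⟨⟨M, hM, rfl⟩, hv⟩
    have := key M hM
    rw [mem_symmDiff] at hv this
    tauto
  · intro hv
    obtain ⟨M, hM, rfl⟩ := mem_image.1 (ht hv)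
    refine ⟨⟨M, hM, rfl⟩, ?_⟩
    have := key M hM
    rw [mem_symmDiff] at this ⊢
    tauto

theorem sup_mem_of_disjoint_union_mem {𝓓 : Set (Finset V)} {S : Finset V} (hempty : ∅ ∈ 𝓓)
    (hunion : ∀ M ∈ 𝓓, ∀ N ∈ 𝓓, Disjoint M N → (M ∩ S).Nonempty → (N ∩ S).Nonempty →
      M ∪ N ∈ 𝓓) {𝓙 : Finset (Finset V)} (hdisj : ∀ M ∈ 𝓙, ∀ N ∈ 𝓙, M ≠ N → Disjoint M N)
    (h𝓓 : ∀ M ∈ 𝓙, M ∈ 𝓓) (hS : ∀ M ∈ 𝓙, (M ∩ S).Nonempty) : 𝓙.sup id ∈ 𝓓 := by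
  classical
  induction 𝓙 using Finset.induction with
  | empty => simpa using hempty
  | insert M 𝓙 hM ih =>
    simp only [mem_insert, forall_eq_or_imp] at hdisj h𝓓 hS
    have ih := ih (fun M hM N hN => (hdisj.2 M hM).2 N hN) h𝓓.2 hS.2
    rw [sup_insert, id, sup_eq_union]
    rcases 𝓙.eq_empty_or_nonempty with rfl | ⟨N, hN⟩
    · simpa using h𝓓.1
    · refine hunion _ h𝓓.1 _ ih ?_ hS.1 ((hS.2 N hN).mono ?_)
      · rw [Finset.disjoint_sup_right]
        exact fun N hN => hdisj.1.2 N hN fun h => hM (h ▸ hN)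
      · exact inter_subset_inter_right (le_sup (f := id) hN)

/-- Let `𝓓` be the family of the differences between `C` and the members of a family. The minimal
nonempty members of `𝓓` are disjoint, and those meeting `C` can be combined freely, as can those
meeting the complement of `C`; hence each of the two kinds contributes at most the VC-dimension to
a set of representatives. -/
theorem exists_card_le_two_mul_vcDim [Fintype V] {𝒜 : Finset (Finset V)} {C : Finset V}
    {𝓓 : Set (Finset V)} (h𝒜 : ∀ M ∈ 𝓓, C ∆ M ∈ 𝒜) (hempty : ∅ ∈ 𝓓)
    (hinter : ∀ M ∈ 𝓓, ∀ N ∈ 𝓓, M ∩ N ∈ 𝓓)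
    (hunion : ∀ M ∈ 𝓓, ∀ N ∈ 𝓓, Disjoint M N → (M ∩ C).Nonempty → (N ∩ C).Nonempty →
      M ∪ N ∈ 𝓓)
    (hunion' : ∀ M ∈ 𝓓, ∀ N ∈ 𝓓, Disjoint M N → (M ∩ Cᶜ).Nonempty → (N ∩ Cᶜ).Nonempty →
      M ∪ N ∈ 𝓓) :
    ∃ T : Finset V, T.card ≤ 2 * 𝒜.vcDim ∧ ∀ M ∈ 𝓓, M.Nonempty → (M ∩ T).Nonempty := by
  classical
  let 𝓜 : Finset (Finset V) := univ.filter fun M => Minimal (fun N => N ∈ 𝓓 ∧ N.Nonempty) M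
  have hmem : ∀ {M}, M ∈ 𝓜 ↔ Minimal (fun N => N ∈ 𝓓 ∧ N.Nonempty) M := by simp [𝓜]
  have hdisj : ∀ M ∈ 𝓜, ∀ N ∈ 𝓜, M ≠ N → Disjoint M N := by
    intro M hM N hN hMN
    rw [hmem] at hM hN
    by_contra h
    rw [Finset.not_disjoint_iff_nonempty_inter] at h
    have hI := And.intro (hinter M hM.prop.1 N hN.prop.1) h
    exact hMN (subset_antisymm ((hM.le_of_le hI inter_subset_left).trans inter_subset_right)
      ((hN.le_of_le hI inter_subset_right).trans inter_subset_left))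
  have hcard : ∀ S : Finset V, (∀ M ∈ 𝓓, ∀ N ∈ 𝓓, Disjoint M N → (M ∩ S).Nonempty →
      (N ∩ S).Nonempty → M ∪ N ∈ 𝓓) →
      (𝓜.filter fun M => (M ∩ S).Nonempty).card ≤ 𝒜.vcDim := by
    intro S hS
    refine card_le_vcDim_of_symmDiff_sup_mem (C := C)
      (fun M hM N hN => hdisj M (mem_filter.1 hM).1 N (mem_filter.1 hN).1)
      (fun M hM => (hmem.1 (mem_filter.1 hM).1).prop.2) fun J hJ => h𝒜 _ ?_
    exact sup_mem_of_disjoint_union_mem hempty hS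
      (fun M hM N hN => hdisj M (mem_filter.1 (hJ hM)).1 N (mem_filter.1 (hJ hN)).1)
      (fun M hM => (hmem.1 (mem_filter.1 (hJ hM)).1).prop.1) fun M hM => (mem_filter.1 (hJ hM)).2
  rcases isEmpty_or_nonempty V with hV | hV
  · exact ⟨∅, by simp, fun M _ ⟨v, _⟩ => isEmptyElim v⟩
  have hne : ∀ M ∈ 𝓜, M.Nonempty := fun M hM => (hmem.1 hM).prop.2
  choose! r hr using hne
  refine ⟨𝓜.image r, ?_, fun M hM hMne => ?_⟩
  · have hcover : 𝓜 ⊆ (𝓜.filter fun M => (M ∩ C).Nonempty) ∪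
        𝓜.filter fun M => (M ∩ Cᶜ).Nonempty := by
      intro M hM
      by_cases h : r M ∈ C
      · exact mem_union_left _ (mem_filter.2 ⟨hM, r M, mem_inter.2 ⟨hr M hM, h⟩⟩)
      · exact mem_union_right _
          (mem_filter.2 ⟨hM, r M, mem_inter.2 ⟨hr M hM, mem_compl.2 h⟩⟩)
    calc (𝓜.image r).card ≤ 𝓜.card := card_image_le
      _ ≤ _ := card_le_card hcover
      _ ≤ _ := card_union_le _ _
      _ ≤ 𝒜.vcDim + 𝒜.vcDim := add_le_add (hcard C hunion) (hcard Cᶜ hunion')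
      _ = 2 * 𝒜.vcDim := (two_mul _).symm
  · obtain ⟨N, hNM, hN⟩ :=
      exists_minimal_le_of_wellFoundedLT (fun N => N ∈ 𝓓 ∧ N.Nonempty) M ⟨hM, hMne⟩
    exact ⟨r N, mem_inter.2 ⟨hNM (hr N (hmem.2 hN)), mem_image_of_mem r (hmem.2 hN)⟩⟩

end Finset

/-! ### Teaching sets and teaching plans -/

namespace Teaching

variable {V : Type*}

theorem IsTeachingSet.anti {𝒞 𝒟 : Finset (Finset V)} {C : Finset V} {T : Finset (V × Bool)}
    (h : IsTeachingSet 𝒞 C T) (h𝒟 : 𝒟 ⊆ 𝒞) (hC : C ∈ 𝒟) : IsTeachingSet 𝒟 C T :=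
  ⟨hC, h.2.1, fun C' hC' => h.2.2 C' (h𝒟 hC')⟩

variable [DecidableEq V]

/-- The vertices of `T` with the labels that `C` gives them. -/
def labeled (C T : Finset V) : Finset (V × Bool) :=
  T.image fun v => (v, decide (v ∈ C))

theorem card_labeled_le (C T : Finset V) : (labeled C T).card ≤ T.card :=
  Finset.card_image_le

theorem consistent_labeled_iff {C C' T : Finset V} :
    Consistent C' (labeled C T) ↔ ∀ v ∈ T, (v ∈ C ↔ v ∈ C') := by
  simp [Consistent, labeled]

/-- Choosing teachable members one after another yields a teaching plan. -/
theorem exists_teachingPlan {k : ℕ} (𝒞 : Finset (Finset V))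
    (h : ∀ 𝒟 ⊆ 𝒞, 𝒟.Nonempty → ∃ C T, IsTeachingSet 𝒟 C T ∧ T.card ≤ k) :
    ∃ P : TeachingPlan 𝒞, P.ord ≤ k := by
  induction 𝒞 using Finset.strongInduction with
  | H 𝒞 ih =>
  rcases 𝒞.eq_empty_or_nonempty with rfl | hne
  · exact ⟨⟨0, Fin.elim0, Fin.elim0, fun i => i.elim0, by simp, fun i => i.elim0⟩,
      by simp [TeachingPlan.ord]⟩
  obtain ⟨C, T, hT, hTk⟩ := h 𝒞 subset_rfl hne
  obtain ⟨P, hP⟩ := ih (𝒞.erase C) (Finset.erase_ssubset hT.1)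
    fun 𝒟 h𝒟 => h 𝒟 (h𝒟.trans (Finset.erase_subset _ _))
  have hmem : ∀ D, D ∈ 𝒞.erase C ↔ ∃ i, P.concept i = D := by
    intro D
    simpa using (Finset.ext_iff.1 P.image_concept D).symm
  have himage : Finset.univ.image (Fin.cons C P.concept : Fin (P.N + 1) → Finset V) = 𝒞 := by
    ext D
    have := hmem D
    rw [Finset.mem_erase] at this
    by_cases hD : D = C
    · subst hD
      simp [Fin.exists_fin_succ, hT.1]
    · simp only [Finset.mem_image, Finset.mem_univ, true_and, Fin.exists_fin_succ, Fin.cons_zero,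
        Fin.cons_succ, ← this, Ne.symm hD, false_or, ne_eq, hD, not_false_iff]
  refine ⟨⟨P.N + 1, Fin.cons C P.concept, Fin.cons T P.examples, ?_, himage, ?_⟩, ?_⟩
  · rw [Fin.cons_injective_iff]
    refine ⟨?_, P.concept_injective⟩
    rintro ⟨i, hi⟩
    exact Finset.notMem_erase C 𝒞 ((hmem C).2 ⟨i, hi⟩)
  · intro i
    cases i using Fin.cases with
    | zero =>
      have h0 : Finset.Ici (0 : Fin (P.N + 1)) = Finset.univ := by ext; simp
      rw [h0, himage]
      exact hT
    | succ i =>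
      have hi : (Finset.Ici i.succ).image (Fin.cons C P.concept : Fin (P.N + 1) → Finset V) =
          (Finset.Ici i).image P.concept := by
        ext D
        simp [Fin.exists_fin_succ]
      rw [hi]
      exact P.isTeachingSet i
  · refine Finset.sup_le fun i _ => ?_
    cases i using Fin.cases with
    | zero => exact hTk
    | succ i => exact (Finset.le_sup (f := fun i => (P.examples i).card) (Finset.mem_univ i)).trans hP

end Teaching

/-! ### Teaching monophonic halfspaces -/

namespace SimpleGraph

open scoped symmDiff

variable {V : Type*} [Fintype V] {G : SimpleGraph V}

theorem mem_mHalfspaces {H : Finset V} : H ∈ G.mHalfspaces ↔ G.IsMHalfspace (H : Set V) := by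
  simp [mHalfspaces]

/-- The two ends of a cut edge, which exclude `∅` and `V`, and a vertex from each minimal difference
between `C` and the other halfspaces cut by this edge form a teaching set for `C`. -/
theorem exists_examples_of_mem_mHalfspaces [DecidableEq V] (hG : G.Connected) {C : Finset V}
    (hC : C ∈ G.mHalfspaces) (hne : C ≠ ∅) (hne' : C ≠ Finset.univ) :
    ∃ T : Finset (V × Bool), T.card ≤ 2 * G.mHalfspaces.vcDim + 2 ∧
      Teaching.IsTeachingSet G.mHalfspaces C T := by
  obtain ⟨u, hu⟩ := Finset.nonempty_iff_ne_empty.2 hne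
  obtain ⟨v, hv⟩ : ∃ v, v ∉ C := by
    by_contra! h
    exact hne' (Finset.eq_univ_iff_forall.2 h)
  obtain ⟨p⟩ := hG.preconnected u v
  obtain ⟨⟨⟨a, b⟩, e⟩, -, ha, hb⟩ := p.exists_boundary_dart (C : Set V) hu hv
  have hcut : ∀ {D : Finset V}, D ∈ G.mHalfspaces → a ∈ D → b ∉ D →
      G.IsCliqueCut a b (D : Set V) := fun hD haD hbD =>
    ⟨(isMHalfspace_iff_hasCliqueBoundaries hG).1 (mem_mHalfspaces.1 hD), e, haD, hbD⟩
  have hmem : ∀ {D : Finset V}, G.IsCliqueCut a b (D : Set V) → D ∈ G.mHalfspaces := fun hD =>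
    mem_mHalfspaces.2 ((isMHalfspace_iff_hasCliqueBoundaries hG).2 hD.toHasCliqueBoundaries)
  have hCcut := hcut hC ha hb
  have hflip : ∀ {M : Finset V} {z : V}, z ∈ M → z ∈ C → z ∉ ((C ∆ M : Finset V) : Set V) := by
    intro M z hzM hzC h
    rw [Finset.mem_coe, Finset.mem_symmDiff] at h
    exact h.elim (fun h => h.2 hzM) fun h => h.2 hzC
  obtain ⟨T, hTcard, hT⟩ := Finset.exists_card_le_two_mul_vcDim (C := C) (𝒜 := G.mHalfspaces)
    (𝓓 := {M | G.IsCliqueCut a b ((C ∆ M : Finset V) : Set V)}) (fun M hM => hmem hM)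
    (by rwa [Set.mem_ofPred_eq, show C ∆ ∅ = C from symmDiff_bot C])
    -- The majority of `C`, `C ∆ M` and `C ∆ N` is `C ∆ (M ∩ N)`.
    (fun M hM N hN => hCcut.majority hM hN fun v => by
      simp only [Finset.mem_coe, Finset.mem_symmDiff, Finset.mem_inter]
      tauto)
    (by
      rintro M hM N hN hdisj ⟨v, hv⟩ ⟨w, hw⟩
      rw [Finset.mem_inter] at hv hw
      refine hCcut.union hG hM hN (fun z => ?_) hv.2 (hflip hv.1 hv.2) hw.2 (hflip hw.1 hw.2)
      have hMN : z ∈ M → z ∉ N := fun h => Finset.disjoint_left.1 hdisj h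
      simp only [Finset.mem_coe, Finset.mem_symmDiff, Finset.mem_union]
      clear * - hMN
      grind)
    (by
      rintro M hM N hN hdisj ⟨v, hv⟩ ⟨w, hw⟩
      rw [Finset.mem_inter, Finset.mem_compl] at hv hw
      rw [Set.mem_ofPred_eq, ← compl_compl (((C ∆ (M ∪ N) : Finset V)) : Set V)]
      refine (hCcut.compl.union hG hM.compl hN.compl (v₁ := v) (v₂ := w) (fun z => ?_) hv.2 ?_
        hw.2 ?_).compl
      · have hMN : z ∈ M → z ∉ N := fun h => Finset.disjoint_left.1 hdisj h
        simp only [Set.mem_compl_iff, Finset.mem_coe, Finset.mem_symmDiff, Finset.mem_union]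
        clear * - hMN
        grind
      · simp [hv.1, hv.2]
      · simp [hw.1, hw.2])
  refine ⟨Teaching.labeled C (insert a (insert b T)), ?_, hC,
    Teaching.consistent_labeled_iff.2 fun _ _ => Iff.rfl, fun D hD hDT => ?_⟩
  · refine (Teaching.card_labeled_le _ _).trans ?_
    have h1 := Finset.card_insert_le a (insert b T)
    have h2 := Finset.card_insert_le b T
    omega
  · rw [Teaching.consistent_labeled_iff] at hDT
    have haD : a ∈ D := (hDT a (by simp)).1 ha
    have hbD : b ∉ D := fun h => hb ((hDT b (by simp)).2 h)
    by_contra hDC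
    have hsd : (C ∆ D).Nonempty := Finset.nonempty_iff_ne_empty.2 fun h =>
      hDC (symmDiff_eq_bot.1 h).symm
    obtain ⟨z, hz⟩ := hT (C ∆ D) (by simpa using hcut hD haD hbD) hsd
    rw [Finset.mem_inter, Finset.mem_symmDiff] at hz
    have := hDT z (by simp [hz.2])
    tauto

end SimpleGraph

theorem mainTheorem11 {V : Type*} [Fintype V] [DecidableEq V] (G : SimpleGraph V)
    (hG : G.Connected) :
    Teaching.teachingDim (G.mHalfspaces \ {∅, Finset.univ})
        ≤ ((2 * G.mHalfspaces.vcDim + 2 : ℕ) : ℕ∞) ∧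
      Teaching.recursiveTeachingDim G.mHalfspaces
        ≤ ((2 * G.mHalfspaces.vcDim + 2 : ℕ) : ℕ∞) := by
  constructor
  · refine iSup₂_le fun C hC => ?_
    simp only [Finset.mem_sdiff, Finset.mem_insert, Finset.mem_singleton, not_or] at hC
    obtain ⟨T, hTcard, hT⟩ :=
      SimpleGraph.exists_examples_of_mem_mHalfspaces hG hC.1 hC.2.1 hC.2.2
    refine (iInf₂_le T (hT.anti Finset.sdiff_subset ?_)).trans (by exact_mod_cast hTcard)
    simpa using hC
  · obtain ⟨P, hP⟩ := Teaching.exists_teachingPlan (k := 2 * G.mHalfspaces.vcDim + 2)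
      G.mHalfspaces fun 𝒟 h𝒟 ⟨C, hC⟩ => by
        by_cases hnt : ∃ D ∈ 𝒟, D ≠ ∅ ∧ D ≠ Finset.univ
        · obtain ⟨D, hD, hD₀, hD₁⟩ := hnt
          obtain ⟨T, hTcard, hT⟩ :=
            SimpleGraph.exists_examples_of_mem_mHalfspaces hG (h𝒟 hD) hD₀ hD₁
          exact ⟨D, T, hT.anti h𝒟 hD, hTcard⟩
        · -- A single vertex tells `∅` and `V` apart.
          have hnt : ∀ D ∈ 𝒟, D ≠ ∅ → D = Finset.univ := fun D hD hD₀ =>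
            by_contra fun hD₁ => hnt ⟨D, hD, hD₀, hD₁⟩
          obtain ⟨v⟩ := hG.nonempty
          refine ⟨C, Teaching.labeled C {v}, ⟨hC, Teaching.consistent_labeled_iff.2
            fun _ _ => Iff.rfl, fun D hD hDC => ?_⟩, (Teaching.card_labeled_le _ _).trans (by simp)⟩
          rw [Teaching.consistent_labeled_iff] at hDC
          have hv := hDC v (by simp)
          by_cases hC₀ : C = ∅ <;> by_cases hD₀ : D = ∅
          · rw [hC₀, hD₀]
          · simp [hC₀, hnt D hD hD₀] at hv
          · simp [hD₀, hnt C hC hC₀] at hv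
          · rw [hnt C hC hC₀, hnt D hD hD₀]
    exact (iInf_le _ P).trans (by exact_mod_cast hP)
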